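/- **Setting.** Let $\Theta_0$ be a compact metric space with metric $d_\theta$, $k\ge 0$ an integer, $\mathcal C$ the space of continuous functions $\Theta_0\to\mathbb R^k$ with the sup norm $\|\mu\|_\infty=\sup_{\theta}\|\mu(\theta)\|$ ($\|\cdot\|$ Euclidean) and its Borel $\sigma$-algebra. Let $\Sigma:\Theta_0\times\Theta_0\to\mathbb R^{k\times k}$ be a continuous covariance function such that the mean-zero Gaussian process $G\sim\mathcal{GP}(0,\Sigma)$ can be realized as a Gaussian random element of $\mathcal C$. Let $A:\mathcal C\to\mathbb R^k$ be a continuous linear map such that $\mathrm{Cov}(G(\theta),A(G))$ is nonsingular for every $\theta\in\Theta_0$. Put $\Sigma_\xi=\mathrm{Var}(A(G))$, $$\psi(\theta)=\mathrm{Cov}(G(\theta),A(G))\,\Sigma_\xi^{-1},\qquad \widetilde\Sigma(\theta_1,\theta_2)=\Sigma(\theta_1,\theta_2)-\psi(\theta_1)\,\Sigma_\xi\,\psi(\theta_2)'.$$ Let $\mathcal H_\mu\subset\mathcal C$ be the reproducing kernel Hilbert space with kernel $\widetilde\Sigma$, and $\overline{\mathcal H}_\mu$ its closure in $\|\cdot\|_\infty$.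 For $\theta\in\Theta_0$ and $\mu\in\overline{\mathcal H}_\mu$, under the parameter value $(\theta,\mu)$ one observes $g\sim\mathcal{GP}(m,\Sigma)$ in $\mathcal C$ with mean function $m(\cdot)=\mu(\cdot)-\psi(\cdot)\psi(\theta)^{-1}\mu(\theta)$ (so that $m(\theta)=0$). Let $\mathcal A$ be a measurable space of actions and $L:\mathcal A\times\Theta_0\to[0,\infty)$ a loss function, measurable in $a$ for each $\theta$. A decision rule $s$ maps $g$ to a (possibly randomized) action $s(g)$, that is, it is a Markov kernel from $\mathcal C$ to $\mathcal A$; its risk function is $(\theta,\mu)\mapsto\mathbb E_{\theta,\mu}[L(s(g),\theta)]$. Fix a class of available decision rules (for instance all of them, or all nonrandomized ones), and let $\mathcal S$ be the class of those available rules whose risk function is finite and continuous on $\Theta_0\times\overline{\mathcal H}_\mu$ with respect to $d((\theta,\mu),(\theta',\mu'))=d_\theta(\theta,\theta')+\|\mu-\mu'\|_\infty$. **Theorem.** Let $\pi(\theta,\mu)=\pi(\theta)\pi(\mu)$ be the product of a probability measure $\pi(\theta)$ on $\Theta_0$ with support $\Theta_0$ and the law $\pi(\mu)$ on $\mathcal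 C$ of $\mu\sim\mathcal{GP}(0,\lambda\widetilde\Sigma)$, where $\lambda>0$. Let $s_\pi\in\mathcal S$ satisfy $$\int\mathbb E_{\theta,\mu}[L(s_\pi(g),\theta)]\,d\pi(\theta,\mu)=\min_{s\in\mathcal S}\int\mathbb E_{\theta,\mu}[L(s(g),\theta)]\,d\pi(\theta,\mu)<\infty .$$ Then $s_\pi$ is admissible relative to $\mathcal S$ and the parameter space $\Theta_0\times\mathcal H_\mu$: there is no $\tilde s\in\mathcal S$ with $\mathbb E_{\theta,\mu}[L(\tilde s(g),\theta)]\le\mathbb E_{\theta,\mu}[L(s_\pi(g),\theta)]$ for all $(\theta,\mu)\in\Theta_0\times\mathcal H_\mu$ and strict inequality for some $(\theta,\mu)\in\Theta_0\times\mathcal H_\mu$. -/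

import Mathlib

open MeasureTheory ProbabilityTheory Set
open scoped ENNReal NNReal Matrix

/-- The space `𝒞` of continuous functions `Θ₀ → ℝ^k`. For compact `Θ₀` its norm is the sup norm
`‖μ‖_∞ = sup_θ ‖μ(θ)‖`, with `‖·‖` the Euclidean norm on `ℝ^k`. -/
abbrev PathSpace (Θ : Type*) [TopologicalSpace Θ] (k : ℕ) : Type _ := C(Θ, EuclideanSpace ℝ (Fin k))

instance PathSpace.instMeasurableSpace {Θ : Type*} [TopologicalSpace Θ] {k : ℕ} :
    MeasurableSpace (PathSpace Θ k) := borel _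

instance PathSpace.instBorelSpace {Θ : Type*} [TopologicalSpace Θ] {k : ℕ} :
    BorelSpace (PathSpace Θ k) := ⟨rfl⟩

/-- The law `γ` of a random continuous function is `GP(m, K)`: a Gaussian measure on `𝒞` (every
continuous linear functional is normally distributed) with mean function `m` and matrix-valued
covariance function `K`. -/
structure IsGPLaw {Θ : Type*} [MetricSpace Θ] [CompactSpace Θ] {k : ℕ}
    (γ : Measure (PathSpace Θ k)) (m : PathSpace Θ k) (K : Θ → Θ → Matrix (Fin k) (Fin k) ℝ) : Prop where
  isGaussian : IsGaussian γ
  mean_eq : ∀ θ i, ∫ x : PathSpace Θ k, x θ i ∂γ = m θ i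
  cov_eq : ∀ θ₁ θ₂ i j, cov[fun x : PathSpace Θ k => x θ₁ i, fun x : PathSpace Θ k => x θ₂ j; γ] = K θ₁ θ₂ i j

/-! ### The reproducing kernel Hilbert space of a matrix-valued kernel -/

/-- A `k × k` matrix valued kernel, as an operator valued kernel on `ℝ^k`. -/
noncomputable def opKernel {Θ : Type*} {k : ℕ} (K : Θ → Θ → Matrix (Fin k) (Fin k) ℝ) :
    Matrix Θ Θ (EuclideanSpace ℝ (Fin k) →L[ℝ] EuclideanSpace ℝ (Fin k)) :=
  Matrix.of fun θ₁ θ₂ => Matrix.toEuclideanCLM (𝕜 := ℝ) (K θ₁ θ₂)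

/-- The RKHS of a positive semidefinite kernel `K`, as a set of functions: the functions
represented by the completion of the span of the functions `K(·, θ) b`. -/
def rkhs {Θ : Type*} {k : ℕ} (K : Θ → Θ → Matrix (Fin k) (Fin k) ℝ)
    (hK : (opKernel K).PosSemidef) : Set (Θ → EuclideanSpace ℝ (Fin k)) :=
  letI : Fact (opKernel K).PosSemidef := ⟨hK⟩
  Set.range fun F : RKHS.OfKernel (opKernel K) => (F : Θ → EuclideanSpace ℝ (Fin k))

/-- A covariance function is positive semidefinite. -/
theorem opKernel_posSemidef_of_cov {Θ Ω : Type*} {k : ℕ} [MeasurableSpace Ω] {P : Measure Ω}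
    [IsProbabilityMeasure P] (X : Θ → Fin k → Ω → ℝ) (hX : ∀ θ i, MemLp (X θ i) 2 P)
    (K : Θ → Θ → Matrix (Fin k) (Fin k) ℝ)
    (hK : ∀ θ₁ θ₂ i j, K θ₁ θ₂ i j = cov[X θ₁ i, X θ₂ j; P]) : (opKernel K).PosSemidef := by
  have t := (RKHS.posSemidef_tfae (K := opKernel K)).out 0 2
  refine t.mpr ⟨?_, fun vv => ?_⟩
  · ext1 θ₁ θ₂
    simp only [opKernel, Matrix.conjTranspose_apply, Matrix.of_apply, ← map_star]
    congr 1
    ext i j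
    simp [Matrix.star_apply, hK, covariance_comm]
  · let Y : Θ → EuclideanSpace ℝ (Fin k) → Ω → ℝ := fun θ w => ∑ i, w i • X θ i
    have hY : ∀ θ w, MemLp (Y θ w) 2 P := fun θ w =>
      memLp_finsetSum' _ fun i _ => (hX θ i).const_smul _
    have key : ∀ θ₁ θ₂ (w₁ w₂ : EuclideanSpace ℝ (Fin k)),
        inner ℝ (opKernel K θ₂ θ₁ w₁) w₂ = cov[Y θ₁ w₁, Y θ₂ w₂; P] := by
      intro θ₁ θ₂ w₁ w₂
      rw [covariance_sum_sum (fun i => (hX θ₁ i).const_smul _) (fun i => (hX θ₂ i).const_smul _)]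
      simp only [opKernel, Matrix.of_apply, PiLp.inner_apply, Matrix.ofLp_toEuclideanCLM,
        Matrix.mulVec, dotProduct, hK, covariance_smul_left, covariance_smul_right]
      simp only [RCLike.inner_apply, conj_trivial, Finset.mul_sum]
      rw [Finset.sum_comm]
      refine Finset.sum_congr rfl fun i _ => Finset.sum_congr rfl fun j _ => ?_
      rw [covariance_comm]
      ring
    simp only [key, Finsupp.sum]
    have : (∑ θ₁ ∈ vv.support, ∑ θ₂ ∈ vv.support, cov[Y θ₁ (vv θ₁), Y θ₂ (vv θ₂); P])
        = Var[∑ θ ∈ vv.support, Y θ (vv θ); P] := by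
      rw [← covariance_self (memLp_finsetSum' _ fun i _ => hY _ _).1.aemeasurable,
        covariance_sum_sum' (fun i _ => hY _ _) (fun i _ => hY _ _)]
    rw [this]
    exact variance_nonneg _ _

/-! ### The Gaussian process limit experiment -/

/-- The data of the Gaussian process experiment: the covariance function `Σ`, continuous in both
arguments, the law of the mean zero Gaussian process `G ~ GP(0, Σ)`, realized with continuous
paths, and a linear functional `A : 𝒞 → ℝ^k` such that `Cov(G(θ), A(G))` is nonsingular for
every `θ`. -/
structure GPExperiment (Θ : Type*) [MetricSpace Θ] [CompactSpace Θ] (k : ℕ) where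
  Sig : Θ → Θ → Matrix (Fin k) (Fin k) ℝ
  continuous_Sig : Continuous fun p : Θ × Θ => Sig p.1 p.2
  noise : Measure (PathSpace Θ k)
  isGPLaw_noise : IsGPLaw noise 0 Sig
  A : PathSpace Θ k →L[ℝ] EuclideanSpace ℝ (Fin k)
  nonsingular : ∀ θ, IsUnit (Matrix.of fun i j : Fin k =>
    cov[fun x : PathSpace Θ k => x θ i, fun x : PathSpace Θ k => A x j; noise]).det

namespace GPExperiment

variable {Θ : Type*} [MetricSpace Θ] [CompactSpace Θ] {k : ℕ} (M : GPExperiment Θ k)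

/-- `Cov(g(θ), ξ)` for `ξ = A(g)`. -/
noncomputable def covXi (θ : Θ) : Matrix (Fin k) (Fin k) ℝ :=
  Matrix.of fun i j =>
    cov[fun x : PathSpace Θ k => x θ i, fun x : PathSpace Θ k => M.A x j; M.noise]

/-- `Var(ξ)` for `ξ = A(g)`. -/
noncomputable def varXi : Matrix (Fin k) (Fin k) ℝ :=
  Matrix.of fun i j =>
    cov[fun x : PathSpace Θ k => M.A x i, fun x : PathSpace Θ k => M.A x j; M.noise]

/-- `ψ(θ) = Cov(g(θ), ξ) Var(ξ)⁻¹`. -/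
noncomputable def psi (θ : Θ) : Matrix (Fin k) (Fin k) ℝ := M.covXi θ * M.varXi⁻¹

/-- The covariance function `Σ̃(θ₁, θ₂) = Σ(θ₁, θ₂) - ψ(θ₁) Var(ξ) ψ(θ₂)ᵀ` of the process
`h(·) = g(·) - ψ(·) ξ`. -/
noncomputable def tildeSig (θ₁ θ₂ : Θ) : Matrix (Fin k) (Fin k) ℝ :=
  M.Sig θ₁ θ₂ - M.psi θ₁ * M.varXi * (M.psi θ₂)ᵀ

theorem memLp_coord (θ : Θ) (i : Fin k) : MemLp (fun x : PathSpace Θ k => x θ i) 2 M.noise := by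
  have := M.isGPLaw_noise.isGaussian
  exact IsGaussian.memLp_dual M.noise
    ((EuclideanSpace.proj i).comp (ContinuousMap.evalCLM ℝ θ)) 2 (by simp)

theorem memLp_A (i : Fin k) : MemLp (fun x : PathSpace Θ k => M.A x i) 2 M.noise := by
  have := M.isGPLaw_noise.isGaussian
  exact IsGaussian.memLp_dual M.noise ((EuclideanSpace.proj i).comp M.A) 2 (by simp)

theorem varXi_transpose : M.varXiᵀ = M.varXi := by
  ext i j
  simp [varXi, covariance_comm]

/-- `Σ̃` is the covariance function of `h(·) = g(·) - ψ(·) ξ`, where `ξ = A(g)`. -/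
theorem tildeSig_eq_cov (θ₁ θ₂ : Θ) (i j : Fin k) :
    M.tildeSig θ₁ θ₂ i j =
      cov[fun x : PathSpace Θ k => x θ₁ i - (M.psi θ₁ *ᵥ M.A x) i,
        fun x : PathSpace Θ k => x θ₂ j - (M.psi θ₂ *ᵥ M.A x) j; M.noise] := by
  have := M.isGPLaw_noise.isGaussian
  have hA : ∀ (θ : Θ) (i l : Fin k), MemLp (fun x : PathSpace Θ k => M.psi θ i l * M.A x l) 2 M.noise :=
    fun θ i l => (M.memLp_A l).const_mul _
  have hS : ∀ (θ : Θ) (i : Fin k),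
      MemLp (fun x : PathSpace Θ k => ∑ l, M.psi θ i l * M.A x l) 2 M.noise :=
    fun θ i => memLp_finsetSum _ fun l _ => hA θ i l
  simp only [Matrix.mulVec, dotProduct]
  rw [covariance_fun_sub_fun_sub (M.memLp_coord _ _) (hS _ _) (M.memLp_coord _ _) (hS _ _),
    covariance_fun_sum_right (hA θ₂ j) (M.memLp_coord _ _),
    covariance_fun_sum_left (hA θ₁ i) (M.memLp_coord _ _),
    covariance_fun_sum_fun_sum (hA θ₁ i) (hA θ₂ j)]
  simp only [covariance_const_mul_left, covariance_const_mul_right, M.isGPLaw_noise.cov_eq]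
  have e1 : ∑ l, M.psi θ₂ j l * cov[fun x : PathSpace Θ k => x θ₁ i, fun x => M.A x l; M.noise]
      = (M.covXi θ₁ * (M.psi θ₂)ᵀ) i j := by
    simp [Matrix.mul_apply, covXi, mul_comm]
  have e2 : ∑ l, M.psi θ₁ i l * cov[fun x : PathSpace Θ k => M.A x l, fun x => x θ₂ j; M.noise]
      = (M.psi θ₁ * (M.covXi θ₂)ᵀ) i j := by
    simp [Matrix.mul_apply, covXi, covariance_comm]
  have e3 : ∑ l, ∑ l', M.psi θ₂ j l' * (M.psi θ₁ i l *
      cov[fun x : PathSpace Θ k => M.A x l, fun x => M.A x l'; M.noise])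
      = (M.psi θ₁ * M.varXi * (M.psi θ₂)ᵀ) i j := by
    simp only [Matrix.mul_apply, varXi, Finset.sum_mul, Matrix.of_apply, Matrix.transpose_apply]
    rw [Finset.sum_comm]
    exact Finset.sum_congr rfl fun _ _ => Finset.sum_congr rfl fun _ _ => by ring
  have inv : M.varXi⁻¹ * M.varXi * M.varXi⁻¹ = M.varXi⁻¹ := by
    by_cases h : IsUnit M.varXi.det
    · rw [Matrix.nonsing_inv_mul _ h, one_mul]
    · simp [Matrix.nonsing_inv_apply_not_isUnit _ h]
  have invT : (M.varXi⁻¹)ᵀ = M.varXi⁻¹ := by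
    rw [Matrix.transpose_nonsing_inv, varXi_transpose]
  have f1 : M.covXi θ₁ * (M.psi θ₂)ᵀ = M.psi θ₁ * M.varXi * (M.psi θ₂)ᵀ := by
    simp only [psi, Matrix.transpose_mul, invT]
    calc _ = M.covXi θ₁ * (M.varXi⁻¹ * M.varXi * M.varXi⁻¹) * (M.covXi θ₂)ᵀ := by
            rw [inv, mul_assoc]
      _ = _ := by simp only [mul_assoc]
  have f2 : M.psi θ₁ * (M.covXi θ₂)ᵀ = M.psi θ₁ * M.varXi * (M.psi θ₂)ᵀ := by
    simp only [psi, Matrix.transpose_mul, invT]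
    calc _ = M.covXi θ₁ * (M.varXi⁻¹ * M.varXi * M.varXi⁻¹) * (M.covXi θ₂)ᵀ := by
            rw [inv]
      _ = _ := by simp only [mul_assoc]
  rw [e1, e2, e3, f1, f2]
  simp [tildeSig]

theorem tildeSig_posSemidef : (opKernel M.tildeSig).PosSemidef := by
  have := M.isGPLaw_noise.isGaussian
  refine opKernel_posSemidef_of_cov
    (fun θ i (x : PathSpace Θ k) => x θ i - (M.psi θ *ᵥ M.A x) i) (fun θ i => ?_) _ M.tildeSig_eq_cov
  refine (M.memLp_coord θ i).sub ?_
  simp only [Matrix.mulVec, dotProduct]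
  exact memLp_finsetSum _ fun l _ => (M.memLp_A l).const_mul _

theorem continuous_covXi : Continuous M.covXi := by
  have := M.isGPLaw_noise.isGaussian
  refine continuous_matrix fun i j => ?_
  have hint : Integrable (fun x : PathSpace Θ k => M.A x j • x) M.noise := by
    have h2 : MemLp (id : PathSpace Θ k → PathSpace Θ k) 2 M.noise := IsGaussian.memLp_id M.noise 2 (by simp)
    exact memLp_one_iff_integrable.mp (MemLp.smul (p := 2) (q := 2) (r := 1) h2 (M.memLp_A j))
  have key : ∀ θ, M.covXi θ i j = (∫ x : PathSpace Θ k, M.A x j • x ∂M.noise) θ i := by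
    intro θ
    have hc := ContinuousLinearMap.integral_comp_comm
      ((EuclideanSpace.proj (𝕜 := ℝ) i).comp (ContinuousMap.evalCLM ℝ θ)) hint
    change _ = (∫ x : PathSpace Θ k, M.A x j • x ∂M.noise) θ i at hc
    rw [← hc]
    simp only [covXi, Matrix.of_apply]
    rw [covariance_eq_sub (M.memLp_coord θ i) (M.memLp_A j), M.isGPLaw_noise.mean_eq]
    simp [mul_comm]
  simp only [key]
  fun_prop

theorem continuous_psi : Continuous M.psi :=
  M.continuous_covXi.matrix_mul continuous_const

/-- The mean function `m(·) = μ(·) - ψ(·) ψ(θ)⁻¹ μ(θ)` of `g` at the parameter value `(θ, μ)`; it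
satisfies `m(θ) = 0`. -/
noncomputable def mean (θ : Θ) (μ : PathSpace Θ k) : PathSpace Θ k where
  toFun t := μ t - WithLp.toLp 2 (M.psi t *ᵥ ((M.psi θ)⁻¹ *ᵥ μ θ))
  continuous_toFun := by
    have := M.continuous_psi
    fun_prop

/-- The law `GP(m, Σ)` of the observed process `g = m + G` at the parameter value `(θ, μ)`. -/
noncomputable def law (θ : Θ) (μ : PathSpace Θ k) : Measure (PathSpace Θ k) :=
  M.noise.map fun x => M.mean θ μ + x

/-- `ℋ_μ`, the RKHS with kernel `Σ̃` (its elements are continuous functions since `Σ̃` is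
continuous). -/
def Hmu : Set (PathSpace Θ k) :=
  {μ | (μ : Θ → EuclideanSpace ℝ (Fin k)) ∈ rkhs M.tildeSig M.tildeSig_posSemidef}

end GPExperiment

/-! ### Decision rules -/

/-- A (possibly randomized) decision rule: given the observation `g`, an action is drawn from the
probability measure `s g`. A nonrandomized rule is a rule whose values are Dirac measures. -/
abbrev DecisionRule (Θ : Type*) [MetricSpace Θ] [CompactSpace Θ] (k : ℕ) (𝓐 : Type*)
    [MeasurableSpace 𝓐] : Type _ := {s : Kernel (PathSpace Θ k) 𝓐 // IsMarkovKernel s}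

namespace GPExperiment

variable {Θ : Type*} [MetricSpace Θ] [CompactSpace Θ] {k : ℕ} (M : GPExperiment Θ k)
  {𝓐 : Type*} [MeasurableSpace 𝓐] (L : 𝓐 → Θ → ℝ≥0)

/-- The risk `E_{θ,μ}[L(s(g), θ)]`, a number in `[0, ∞]`. -/
noncomputable def risk (s : DecisionRule Θ k 𝓐) (p : Θ × PathSpace Θ k) : ℝ≥0∞ :=
  ∫⁻ g, ∫⁻ a, (L a p.1 : ℝ≥0∞) ∂(s.1 g) ∂(M.law p.1 p.2)

/-- The class `𝒮` of those rules, among the available rules `𝓓`, whose risk function is real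
valued and continuous on `Θ₀ × closure ℋ_μ` (the closure in sup norm), for the metric
`d_θ(θ, θ') + ‖μ - μ'‖_∞`. -/
def continuousRiskRules (𝓓 : Set (DecisionRule Θ k 𝓐)) : Set (DecisionRule Θ k 𝓐) :=
  {s ∈ 𝓓 | (∀ p ∈ (univ : Set Θ) ×ˢ closure M.Hmu, M.risk L s p ≠ ∞) ∧
    ContinuousOn (M.risk L s) ((univ : Set Θ) ×ˢ closure M.Hmu)}

/-- The integrated risk `∫ E_{θ,μ}[L(s(g), θ)] dπ(θ, μ)`. -/
noncomputable def integratedRisk [MeasurableSpace Θ] (π : Measure (Θ × PathSpace Θ k))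
    (s : DecisionRule Θ k 𝓐) : ℝ≥0∞ :=
  ∫⁻ p, M.risk L s p ∂π

/-- `s` is a Bayes rule for the prior `π` within the class `𝒮`: its integrated risk is the
(finite) minimum of the integrated risk over `𝒮`. -/
def IsBayesWithin [MeasurableSpace Θ] (π : Measure (Θ × PathSpace Θ k))
    (𝒮 : Set (DecisionRule Θ k 𝓐)) (s : DecisionRule Θ k 𝓐) : Prop :=
  s ∈ 𝒮 ∧ M.integratedRisk L π s ≠ ∞ ∧
    ∀ s' ∈ 𝒮, M.integratedRisk L π s ≤ M.integratedRisk L π s'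

/-- `s` is admissible relative to the class `𝒮` and the parameter space `T`: no rule in `𝒮` has
weakly lower risk on all of `T` and strictly lower risk somewhere in `T`. -/
def IsAdmissibleRelTo (𝒮 : Set (DecisionRule Θ k 𝓐)) (T : Set (Θ × PathSpace Θ k))
    (s : DecisionRule Θ k 𝓐) : Prop :=
  s ∈ 𝒮 ∧ ¬ ∃ s' ∈ 𝒮, (∀ p ∈ T, M.risk L s' p ≤ M.risk L s p) ∧
    ∃ p ∈ T, M.risk L s' p < M.risk L s p

end GPExperiment

/-! Suppose a rule in the class dominates, strictly at some point of `Θ × Hmu`. By continuity of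
both risks the weak inequality extends to `Θ × closure Hmu` and the strict one holds near that
point. If the prior gives full mass to `Θ × closure Hmu` and positive mass to every neighbourhood of
a point of `Θ × Hmu`, the integrated risk drops strictly, contradicting the Bayes property
(`not_lt_of_lintegral_le_of_continuousOn_closure`).

What remains is that the support of `GP(0, λΣ̃)` lies between `Hmu` and its closure. The link is the
covariance section `E[⟨b, x(θ)⟩ x] = λ Σ̃(·, θ) b`: these sections generate the RKHS. The support is
a closed subspace, by rotation invariance, so Hahn–Banach reduces both inclusions to functionals.
One vanishing almost surely kills every section, which puts sections, and then their limits, in the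
support (`rkhs_subset_support`). One killing every section has zero second moment, so it vanishes
almost surely (`support_subset_closure_rkhs`). -/

/-! ### Supports of Gaussian measures and separation by functionals -/

open Filter Topology in
/-- The support of a centered Gaussian measure is stable under rotations. -/
theorem ProbabilityTheory.IsGaussian.rotation_mem_support {E : Type*} [NormedAddCommGroup E]
    [NormedSpace ℝ E] [CompleteSpace E] [SecondCountableTopology E] [MeasurableSpace E]
    [BorelSpace E] {γ : Measure E} [IsGaussian γ] (h0 : γ[id] = 0) {a b : E}
    (ha : a ∈ γ.support) (hb : b ∈ γ.support) (t : ℝ) :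
    Real.cos t • a + Real.sin t • b ∈ γ.support := by
  rw [Measure.mem_support_iff_forall] at ha hb ⊢
  intro U hU
  have hcont : Continuous fun p : E × E => Real.cos t • p.1 + Real.sin t • p.2 := by fun_prop
  obtain ⟨V, hVU, hVo, hV⟩ := mem_nhds_iff.mp hU
  have hpre := (hcont.tendsto (a, b)) (hVo.mem_nhds hV)
  rw [mem_map, mem_nhds_prod_iff] at hpre
  obtain ⟨A, hA, B, hB, hAB⟩ := hpre
  calc 0 < γ A * γ B := ENNReal.mul_pos (ha A hA).ne' (hb B hB).ne'
    _ = (γ.prod γ) (A ×ˢ B) := (Measure.prod_prod _ _).symm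
    _ ≤ (γ.prod γ) (ContinuousLinearMap.rotation t ⁻¹' (V ×ˢ univ)) := by
        refine measure_mono fun p hp => ?_
        simpa [ContinuousLinearMap.rotation_apply] using hAB hp
    _ = ((γ.prod γ).map (ContinuousLinearMap.rotation t)) (V ×ˢ univ) :=
        (Measure.map_apply (by fun_prop) (hVo.measurableSet.prod .univ)).symm
    -- The product of a centered Gaussian with itself is rotation invariant.
    _ = γ V := by rw [IsGaussian.map_rotation_eq_self h0]; simp
    _ ≤ γ U := measure_mono hVU

/-- The support of a centered Gaussian measure, as a linear subspace. -/
noncomputable def ProbabilityTheory.IsGaussian.supportSubmodule {E : Type*} [NormedAddCommGroup E]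
    [NormedSpace ℝ E] [CompleteSpace E] [SecondCountableTopology E] [MeasurableSpace E]
    [BorelSpace E] (γ : Measure E) [IsGaussian γ] (h0 : γ[id] = 0) : Submodule ℝ E :=
  have rot {a b : E} (ha : a ∈ γ.support) (hb : b ∈ γ.support) (t : ℝ) :=
    IsGaussian.rotation_mem_support h0 ha hb t
  have neg {a : E} (ha : a ∈ γ.support) : -a ∈ γ.support := by
    simpa using rot ha ha Real.pi
  have zero : (0 : E) ∈ γ.support := by
    obtain ⟨a, ha⟩ := Measure.nonempty_support (IsProbabilityMeasure.ne_zero γ)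
    simpa using rot ha (neg ha) (Real.pi / 4)
  -- The angle `π/4` gives `(a + b)/√2`; the case `a = b` gives scaling by `√2`, which then removes
  -- the factor and yields sums.
  have diag {a b : E} (ha : a ∈ γ.support) (hb : b ∈ γ.support) :
      (√2 / 2) • (a + b) ∈ γ.support := by
    simpa [smul_add] using rot ha hb (Real.pi / 4)
  have sqrt_two {a : E} (ha : a ∈ γ.support) : √2 • a ∈ γ.support := by
    have := diag ha ha
    rw [← two_smul ℝ a, smul_smul] at this
    simpa using this
  have add {a b : E} (ha : a ∈ γ.support) (hb : b ∈ γ.support) : a + b ∈ γ.support := by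
    have := diag (sqrt_two ha) (sqrt_two hb)
    rw [← smul_add, smul_smul, div_mul_eq_mul_div] at this
    simpa using this
  have two_pow (n : ℕ) {a : E} (ha : a ∈ γ.support) : (2 : ℝ) ^ n • a ∈ γ.support := by
    induction n with
    | zero => simpa using ha
    | succ n ih =>
      rw [pow_succ', mul_smul, two_smul]
      exact add ih ih
  { carrier := γ.support
    add_mem' := add
    zero_mem' := zero
    smul_mem' := fun c a ha => by
      obtain ⟨n, hn⟩ := pow_unbounded_of_one_lt |c| (one_lt_two (α := ℝ))
      have h2 : (0 : ℝ) < 2 ^ n := by positivity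
      have hc : |c / 2 ^ n| ≤ 1 := by
        rw [abs_div, abs_of_pos h2, div_le_one h2]
        exact hn.le
      -- Rotating `2 ^ n • a` against `0` multiplies it by a cosine, here chosen as `c / 2 ^ n`.
      have := rot (two_pow n ha) zero (Real.arccos (c / 2 ^ n))
      rw [Real.cos_arccos (abs_le.mp hc).1 (abs_le.mp hc).2, smul_zero, add_zero, smul_smul,
        div_mul_cancel₀ _ h2.ne'] at this
      exact this }

/-- A vector outside a closed subspace is separated from it by a continuous functional vanishing
on the subspace. -/
theorem Submodule.exists_strongDual_eq_zero_ne_zero {E : Type*} [NormedAddCommGroup E]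
    [NormedSpace ℝ E] (S : Submodule ℝ E) (hS : IsClosed (S : Set E)) {x : E} (hx : x ∉ S) :
    ∃ l : StrongDual ℝ E, (∀ y ∈ S, l y = 0) ∧ l x ≠ 0 := by
  obtain ⟨l, u, hlx, hl⟩ := geometric_hahn_banach_point_closed S.convex hS hx
  have hu : u < 0 := by simpa using hl 0 S.zero_mem
  refine ⟨l, fun y hy => ?_, fun h => by linarith⟩
  by_contra hne
  -- If `l y ≠ 0`, this multiple of `y` has value exactly `u`, though `l` exceeds `u` on the
  -- subspace.
  have := hl ((u / l y) • y) (S.smul_mem _ hy)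
  rw [map_smul, smul_eq_mul, div_mul_cancel₀ _ hne] at this
  exact lt_irrefl _ this

/-- The support is a closed subspace of full measure, so a functional separating `x` from it would
vanish almost everywhere but not at `x`. -/
theorem ProbabilityTheory.IsGaussian.mem_support_of_forall_strongDual {E : Type*}
    [NormedAddCommGroup E] [NormedSpace ℝ E] [CompleteSpace E] [SecondCountableTopology E]
    [MeasurableSpace E] [BorelSpace E] {γ : Measure E} [IsGaussian γ] (h0 : γ[id] = 0) {x : E}
    (hx : ∀ l : StrongDual ℝ E, (∀ᵐ y ∂γ, l y = 0) → l x = 0) : x ∈ γ.support := by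
  by_contra hxs
  obtain ⟨l, hl, hlx⟩ := (IsGaussian.supportSubmodule γ h0).exists_strongDual_eq_zero_ne_zero
    Measure.isClosed_support hxs
  refine hlx (hx l ?_)
  filter_upwards [Measure.support_mem_ae (μ := γ)] with y hy using hl y hy

/-- A closed subspace contains the support of `γ` as soon as every continuous functional that
vanishes on it vanishes `γ`-almost everywhere. -/
theorem MeasureTheory.Measure.support_subset_of_forall_strongDual {E : Type*}
    [NormedAddCommGroup E] [NormedSpace ℝ E] [MeasurableSpace E] {γ : Measure E}
    (S : Submodule ℝ E) (hS : IsClosed (S : Set E))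
    (h : ∀ l : StrongDual ℝ E, (∀ y ∈ S, l y = 0) → ∀ᵐ y ∂γ, l y = 0) :
    γ.support ⊆ S := by
  intro x hx
  by_contra hxS
  obtain ⟨l, hl, hlx⟩ := S.exists_strongDual_eq_zero_ne_zero hS hxS
  exact hlx (Measure.support_subset_of_isClosed (isClosed_eq l.continuous continuous_const)
    (h l hl) hx)

/-! ### Covariance sections of a Gaussian process -/

section CovarianceSections

variable {Θ : Type*} [MetricSpace Θ] [CompactSpace Θ] {k : ℕ}

/-- The function `t ↦ E[⟨x(θ), b⟩ x(t)]` for a random continuous function `x` with law `γ`. -/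
noncomputable def covSection (γ : Measure (PathSpace Θ k)) (θ : Θ)
    (b : EuclideanSpace ℝ (Fin k)) : PathSpace Θ k :=
  ∫ x : PathSpace Θ k, inner ℝ b (x θ) • x ∂γ

theorem integrable_strongDual_smul (γ : Measure (PathSpace Θ k)) [IsGaussian γ]
    (l : StrongDual ℝ (PathSpace Θ k)) : Integrable (fun x : PathSpace Θ k => l x • x) γ :=
  memLp_one_iff_integrable.mp (MemLp.smul (p := 2) (q := 2) (r := 1)
    (IsGaussian.memLp_id γ 2 (by simp)) (IsGaussian.memLp_dual γ l 2 (by simp)))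

/-- The functional `x ↦ ⟨b, x(θ)⟩`. -/
noncomputable def evalInner {Θ : Type*} [MetricSpace Θ] {k : ℕ} (θ : Θ) (b : EuclideanSpace ℝ (Fin k)) :
    StrongDual ℝ (PathSpace Θ k) :=
  (innerSL ℝ b).comp (ContinuousMap.evalCLM ℝ θ)

@[simp]
theorem evalInner_apply {Θ : Type*} [MetricSpace Θ] {k : ℕ} (θ : Θ) (b : EuclideanSpace ℝ (Fin k)) (x : PathSpace Θ k) :
    evalInner θ b x = inner ℝ b (x θ) := rfl

theorem strongDual_covSection (γ : Measure (PathSpace Θ k)) [IsGaussian γ]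
    (l : StrongDual ℝ (PathSpace Θ k)) (θ : Θ) (b : EuclideanSpace ℝ (Fin k)) :
    l (covSection γ θ b) = ∫ x : PathSpace Θ k, inner ℝ b (x θ) * l x ∂γ := by
  have := l.integral_comp_comm (integrable_strongDual_smul γ (evalInner θ b))
  simp only [evalInner_apply, map_smul, smul_eq_mul] at this
  exact this.symm

/-- A functional that annihilates all covariance sections vanishes almost everywhere. -/
theorem ae_eq_zero_of_forall_covSection (γ : Measure (PathSpace Θ k)) [IsGaussian γ]
    (l : StrongDual ℝ (PathSpace Θ k)) (h : ∀ θ b, l (covSection γ θ b) = 0) :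
    ∀ᵐ x ∂γ, l x = 0 := by
  have hint := integrable_strongDual_smul γ l
  -- Pairing this vector with `b` at `θ` gives `l (covSection γ θ b)`. Applying `l` to it gives the
  -- second moment of `l`.
  have hv : ∫ x, l x • x ∂γ = 0 := by
    ext1 θ
    refine ext_inner_left ℝ fun b => ?_
    rw [← evalInner_apply, ← ContinuousLinearMap.integral_comp_comm _ hint]
    simpa [strongDual_covSection, mul_comm] using h θ b
  have hsq : ∫ x, l x * l x ∂γ = 0 := by
    simpa [hv] using l.integral_comp_comm hint
  have := (integral_eq_zero_iff_of_nonneg (fun x => mul_self_nonneg (l x))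
    (by simpa using l.integrable_comp hint)).mp hsq
  filter_upwards [this] with x hx using mul_self_eq_zero.mp hx

namespace IsGPLaw

variable {γ : Measure (PathSpace Θ k)} {K : Θ → Θ → Matrix (Fin k) (Fin k) ℝ}

theorem integral_id_eq_zero (h : IsGPLaw γ 0 K) : γ[id] = 0 := by
  have := h.isGaussian
  ext θ i
  have := ((EuclideanSpace.proj (𝕜 := ℝ) i).comp
    (ContinuousMap.evalCLM ℝ θ)).integral_comp_comm (IsGaussian.integrable_id (μ := γ))
  exact this.symm.trans (h.mean_eq θ i)

theorem covSection_apply (h : IsGPLaw γ 0 K) (θ t : Θ) (b : EuclideanSpace ℝ (Fin k)) :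
    covSection γ θ b t = opKernel K t θ b := by
  have := h.isGaussian
  have hL (θ : Θ) (i : Fin k) : MemLp (fun x : PathSpace Θ k => x θ i) 2 γ :=
    IsGaussian.memLp_dual γ ((EuclideanSpace.proj i).comp (ContinuousMap.evalCLM ℝ θ)) 2 (by simp)
  ext i
  have h1 := strongDual_covSection γ
    ((EuclideanSpace.proj (𝕜 := ℝ) i).comp (ContinuousMap.evalCLM ℝ t)) θ b
  change covSection γ θ b t i = ∫ x : PathSpace Θ k, inner ℝ b (x θ) * x t i ∂γ at h1
  rw [h1]
  simp only [PiLp.inner_apply, RCLike.inner_apply, conj_trivial, Finset.sum_mul, opKernel,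
    Matrix.of_apply, Matrix.ofLp_toEuclideanCLM, Matrix.mulVec, dotProduct]
  have hI (j : Fin k) : Integrable (fun x : PathSpace Θ k => x θ j * b j * x t i) γ := by
    convert! ((hL t i).integrable_mul (hL θ j)).mul_const (b j) using 2
    simp only [Pi.mul_apply]
    ring
  rw [integral_finsetSum _ fun j _ => hI j]
  refine Finset.sum_congr rfl fun j _ => ?_
  rw [← h.cov_eq, covariance_eq_sub (hL t i) (hL θ j), h.mean_eq, h.mean_eq]
  simp only [ContinuousMap.zero_apply, PiLp.zero_apply, mul_zero, sub_zero, ← integral_mul_const]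
  exact integral_congr_ae (.of_forall fun x => by simp only [Pi.mul_apply]; ring)

theorem covSection_mem_support (h : IsGPLaw γ 0 K) (θ : Θ) (b : EuclideanSpace ℝ (Fin k)) :
    covSection γ θ b ∈ γ.support := by
  have := h.isGaussian
  refine IsGaussian.mem_support_of_forall_strongDual h.integral_id_eq_zero fun l hl => ?_
  rw [strongDual_covSection]
  refine integral_eq_zero_of_ae ?_
  filter_upwards [hl] with x hx
  simp [hx]

end IsGPLaw

end CovarianceSections

/-! ### The RKHS and the support of the Gaussian law -/

section ReproducingKernel

variable {Θ : Type*} [MetricSpace Θ] [CompactSpace Θ] {k : ℕ}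

/-- The continuous functions in the RKHS of `K`, as a linear subspace. -/
def rkhsSubmodule (K : Θ → Θ → Matrix (Fin k) (Fin k) ℝ) (hK : (opKernel K).PosSemidef) :
    Submodule ℝ (PathSpace Θ k) where
  carrier := {μ | (μ : Θ → EuclideanSpace ℝ (Fin k)) ∈ rkhs K hK}
  add_mem' := by
    let _ : Fact (opKernel K).PosSemidef := ⟨hK⟩
    rintro f g ⟨F, hF⟩ ⟨G, hG⟩
    exact ⟨F + G, by simp only [RKHS.coe_add, ContinuousMap.coe_add] at *; rw [hF, hG]⟩
  zero_mem' := by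
    let _ : Fact (opKernel K).PosSemidef := ⟨hK⟩
    exact ⟨0, by simp⟩
  smul_mem' := by
    let _ : Fact (opKernel K).PosSemidef := ⟨hK⟩
    rintro c f ⟨F, hF⟩
    exact ⟨c • F, by simp only [RKHS.coe_smul, ContinuousMap.coe_smul] at *; rw [hF]⟩

/-- The norm of the kernel section is `√‖K(θ, θ)‖`, continuous on a compact space. The bound turns
convergence in RKHS norm into uniform convergence. -/
theorem exists_norm_kerFun_le (K : Θ → Θ → Matrix (Fin k) (Fin k) ℝ)
    [Fact (opKernel K).PosSemidef] (hc : Continuous fun θ => K θ θ) :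
    ∃ C, ∀ θ, ‖RKHS.kerFun (RKHS.OfKernel (opKernel K)) θ‖ ≤ C := by
  have hcont : Continuous fun θ => √‖opKernel K θ θ‖ := by
    have : Continuous (Matrix.toEuclideanCLM (n := Fin k) (𝕜 := ℝ)) :=
      LinearMap.continuous_of_finiteDimensional
        (Matrix.toEuclideanCLM (n := Fin k) (𝕜 := ℝ)).toAlgEquiv.toLinearMap
    exact (this.comp hc).norm.sqrt
  obtain ⟨C, hC⟩ := (isCompact_range hcont).bddAbove
  refine ⟨C, fun θ => ?_⟩
  rw [RKHS.norm_kerFun_eq_sqrt_norm_kernel, RKHS.OfKernel.kernel_ofKernel]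
  exact hC ⟨θ, rfl⟩

namespace IsGPLaw

variable {γ : Measure (PathSpace Θ k)} {K : Θ → Θ → Matrix (Fin k) (Fin k) ℝ} {lam : ℝ}

theorem covSection_eq_smul_kerFun [Fact (opKernel K).PosSemidef]
    (h : IsGPLaw γ 0 fun θ₁ θ₂ => lam • K θ₁ θ₂) (θ : Θ) (b : EuclideanSpace ℝ (Fin k)) :
    (covSection γ θ b : Θ → EuclideanSpace ℝ (Fin k)) =
      lam • ⇑(RKHS.kerFun (RKHS.OfKernel (opKernel K)) θ b) := by
  ext1 t
  rw [h.covSection_apply, Pi.smul_apply, RKHS.kerFun_apply, RKHS.OfKernel.kernel_ofKernel]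
  simp [opKernel]

theorem support_subset_closure_rkhs (h : IsGPLaw γ 0 fun θ₁ θ₂ => lam • K θ₁ θ₂)
    (hK : (opKernel K).PosSemidef) :
    γ.support ⊆ closure {μ : PathSpace Θ k | (μ : Θ → EuclideanSpace ℝ (Fin k)) ∈ rkhs K hK} := by
  let _ : Fact (opKernel K).PosSemidef := ⟨hK⟩
  have := h.isGaussian
  refine Measure.support_subset_of_forall_strongDual (rkhsSubmodule K hK).topologicalClosure
    (Submodule.isClosed_topologicalClosure _) fun l hl => ?_
  refine ae_eq_zero_of_forall_covSection γ l fun θ b =>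
    hl _ (Submodule.le_topologicalClosure _ ?_)
  exact ⟨lam • RKHS.kerFun (RKHS.OfKernel (opKernel K)) θ b, by
    rw [h.covSection_eq_smul_kerFun]
    exact RKHS.coe_smul _ _⟩

-- Kernel sections are covariance sections divided by `lam`, so their span lies in the support. The
-- span is dense in RKHS norm, hence uniformly approximates every RKHS function, and the support is
-- closed.
open Filter in
theorem rkhs_subset_support (h : IsGPLaw γ 0 fun θ₁ θ₂ => lam • K θ₁ θ₂) (hlam : lam ≠ 0)
    (hK : (opKernel K).PosSemidef) (hc : Continuous fun θ => K θ θ) :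
    {μ : PathSpace Θ k | (μ : Θ → EuclideanSpace ℝ (Fin k)) ∈ rkhs K hK} ⊆ γ.support := by
  let _ : Fact (opKernel K).PosSemidef := ⟨hK⟩
  have := h.isGaussian
  rintro μ ⟨F, hF⟩
  let S := IsGaussian.supportSubmodule γ h.integral_id_eq_zero
  have hspan : ∀ G ∈ Submodule.span ℝ
      {RKHS.kerFun (RKHS.OfKernel (opKernel K)) θ b | (θ) (b)},
      ∃ g ∈ S, (g : Θ → EuclideanSpace ℝ (Fin k)) = ⇑G := by
    intro G hG
    induction hG using Submodule.span_induction with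
    | mem G hG =>
      obtain ⟨θ, b, rfl⟩ := hG
      refine ⟨lam⁻¹ • covSection γ θ b, S.smul_mem _ (h.covSection_mem_support θ b), ?_⟩
      rw [ContinuousMap.coe_smul, h.covSection_eq_smul_kerFun, inv_smul_smul₀ hlam]
    | zero => exact ⟨0, S.zero_mem, by simp⟩
    | add G₁ G₂ _ _ h₁ h₂ =>
      obtain ⟨g₁, hg₁, e₁⟩ := h₁
      obtain ⟨g₂, hg₂, e₂⟩ := h₂
      exact ⟨g₁ + g₂, S.add_mem hg₁ hg₂, by simp [e₁, e₂]⟩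
    | smul c G _ h₁ =>
      obtain ⟨g, hg, e⟩ := h₁
      exact ⟨c • g, S.smul_mem c hg, by simp [e]⟩
  have hFcl : F ∈ closure (Submodule.span ℝ
      {RKHS.kerFun (RKHS.OfKernel (opKernel K)) θ b | (θ) (b)} : Set _) := by
    rw [← Submodule.topologicalClosure_coe, RKHS.kerFun_dense]
    trivial
  obtain ⟨G, hG, hlim⟩ := mem_closure_iff_seq_limit.mp hFcl
  choose g hgS hg using fun n => hspan (G n) (hG n)
  obtain ⟨C, hC⟩ := exists_norm_kerFun_le K hc
  have hunif := RKHS.tendstoUniformly_of_norm_kerFun_le hC hlim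
  refine Measure.isClosed_support.mem_of_tendsto (f := g) (b := atTop) ?_ (.of_forall hgS)
  rw [ContinuousMap.tendsto_iff_tendstoUniformly]
  simpa only [hg, ← hF] using hunif

end IsGPLaw

end ReproducingKernel

/-! ### Product priors and admissibility -/

theorem GPExperiment.continuous_tildeSig_diag {Θ : Type*} [MetricSpace Θ] [CompactSpace Θ] {k : ℕ}
    (M : GPExperiment Θ k) : Continuous fun θ => M.tildeSig θ θ := by
  have h1 : Continuous fun θ => M.Sig θ θ :=
    M.continuous_Sig.comp (continuous_id.prodMk continuous_id)
  have h2 := M.continuous_psi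
  exact h1.sub ((h2.matrix_mul continuous_const).matrix_mul h2.matrix_transpose)

theorem MeasureTheory.Measure.mem_support_prod {X Y : Type*} [TopologicalSpace X]
    [TopologicalSpace Y] [MeasurableSpace X] [MeasurableSpace Y] {μ : Measure X} {ν : Measure Y}
    [SFinite ν] {p : X × Y} (h1 : p.1 ∈ μ.support) (h2 : p.2 ∈ ν.support) :
    p ∈ (μ.prod ν).support := by
  rw [Measure.mem_support_iff_forall] at h1 h2 ⊢
  intro U hU
  rw [← Prod.mk.eta (p := p), mem_nhds_prod_iff] at hU
  obtain ⟨A, hA, B, hB, hAB⟩ := hU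
  calc 0 < μ A * ν B := ENNReal.mul_pos (h1 A hA).ne' (h2 B hB).ne'
    _ = (μ.prod ν) (A ×ˢ B) := (Measure.prod_prod _ _).symm
    _ ≤ (μ.prod ν) U := measure_mono hAB

open Filter Topology in
/-- Two functions, continuous on the closure of `T`, a set which carries the measure `π` and
is contained in its support: if `f ≤ g` on `T` and the integrals satisfy `∫ g ≤ ∫ f < ∞`, then
there is no point of `T` at which `f < g`. -/
theorem not_lt_of_lintegral_le_of_continuousOn_closure {X : Type*} [TopologicalSpace X]
    [MeasurableSpace X] [BorelSpace X] {π : Measure X} {T : Set X} (hT : closure T ∈ ae π)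
    (hTs : T ⊆ π.support) {f g : X → ℝ≥0∞} (hf : ContinuousOn f (closure T))
    (hg : ContinuousOn g (closure T)) (hle : ∀ x ∈ T, f x ≤ g x)
    (hint : ∫⁻ x, g x ∂π ≤ ∫⁻ x, f x ∂π) (hfin : ∫⁻ x, g x ∂π ≠ ∞) {x : X} (hx : x ∈ T) :
    ¬ f x < g x := by
  intro hlt
  have hxcl := subset_closure hx
  have hae : f ≤ᵐ[π] g := by
    filter_upwards [hT] with y hy using le_on_closure hle hf hg hy
  have hgm : AEMeasurable g π := by
    rw [← Measure.restrict_eq_self_of_ae_mem hT]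
    exact hg.aemeasurable isClosed_closure.measurableSet
  have hev : ∀ᶠ y in 𝓝[closure T] x, f y < g y :=
    (hf x hxcl).eventually_lt (hg x hxcl) hlt
  rw [eventually_nhdsWithin_iff] at hev
  -- The neighbourhood is `{y | y ∈ closure T → f y < g y}`; the premise holds almost everywhere.
  have hpos := (Measure.mem_support_iff_forall x).mp (hTs hx) _ hev
  refine hint.not_gt (lintegral_strict_mono_of_ae_le_of_ae_lt_on hgm
    (ne_top_of_le_ne_top hfin (lintegral_mono_ae hae)) hae hpos.ne' ?_)
  filter_upwards [hT] with y hy hy' using hy' hy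

theorem mainTheorem8 {Θ : Type*} [MetricSpace Θ] [CompactSpace Θ] [MeasurableSpace Θ]
    [BorelSpace Θ] {k : ℕ} (M : GPExperiment Θ k)
    {𝓐 : Type*} [MeasurableSpace 𝓐] (L : 𝓐 → Θ → ℝ≥0) (hL : ∀ θ, Measurable fun a => L a θ)
    (𝓓 : Set (DecisionRule Θ k 𝓐))
    (πθ : Measure Θ) [IsProbabilityMeasure πθ] (hπθ : πθ.support = univ)
    (lam : ℝ) (hlam : 0 < lam)
    (πμ : Measure (PathSpace Θ k)) (hπμ : IsGPLaw πμ 0 fun θ₁ θ₂ => lam • M.tildeSig θ₁ θ₂)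
    (sπ : DecisionRule Θ k 𝓐)
    (hsπ : M.IsBayesWithin L (πθ.prod πμ) (M.continuousRiskRules L 𝓓) sπ) :
    M.IsAdmissibleRelTo L (M.continuousRiskRules L 𝓓) ((univ : Set Θ) ×ˢ M.Hmu) sπ := by
  obtain ⟨hmem, hfin, hmin⟩ := hsπ
  refine ⟨hmem, ?_⟩
  rintro ⟨s, hs, hle, p, hp, hlt⟩
  have := hπμ.isGaussian
  -- This identifies the set where risks are assumed continuous with the closure of the parameter
  -- space.
  have hcl : closure ((univ : Set Θ) ×ˢ M.Hmu) = univ ×ˢ closure M.Hmu := by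
    rw [closure_prod_eq, closure_univ]
  have hH : M.Hmu ⊆ πμ.support :=
    hπμ.rkhs_subset_support hlam.ne' M.tildeSig_posSemidef M.continuous_tildeSig_diag
  have hsupp : πμ.support ⊆ closure M.Hmu :=
    hπμ.support_subset_closure_rkhs M.tildeSig_posSemidef
  refine not_lt_of_lintegral_le_of_continuousOn_closure (π := πθ.prod πμ) ?_ (fun q hq => ?_)
    (hcl ▸ hs.2.2) (hcl ▸ hmem.2.2) hle (hmin s hs) hfin hp hlt
  · rw [hcl]
    have hae : ∀ᵐ x ∂πμ, x ∈ closure M.Hmu :=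
      Filter.mem_of_superset Measure.support_mem_ae hsupp
    filter_upwards [Measure.quasiMeasurePreserving_snd.ae hae] with q hq using ⟨trivial, hq⟩
  · exact Measure.mem_support_prod (by rw [hπθ]; trivial) (hH hq.2)
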